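/- Let $n\ge 1$, let $\Omega\subset\mathbb{R}^n$ be a bounded Lipschitz domain (open, connected), and let $\mathcal M$ be a smooth $(n-1)$-dimensional manifold (only $\mathcal M\cap\Omega$ matters, and $\mathcal M\cap\Omega$ is a smooth embedded hypersurface) that divides $\Omega$ into two Lipschitz subdomains: $\Omega\setminus\mathcal M=\Omega_+\cup\Omega_-$ with $\Omega_\pm$ disjoint bounded Lipschitz domains. Let $\mu$ be the surface measure on $\mathcal M\cap\Omega$; integrals over $\mathcal M$ and the space $L^2(\mathcal M)$ refer to $\mathcal M\cap\Omega$ and $\mu$. Write $\|\cdot\|_D$ for the norm of $L^2(D)$ or $L^2(D,\mathbb{R}^n)$ and $\|\cdot\|_{\mathcal M}$ for that of $L^2(\mathcal M)$. Functions in $H^1(\Omega)$ are evaluated on $\mathcal M$ through their traces. Let $\psi:\mathcal M\to\mathbb{R}$ be smooth and let $\varphi\in H^{1/2}(\partial\Omega)$, extended to a function $\varphi\in H^1(\Omega)$. Put $$\mathbb K=\{v\in H^1(\Omega):\ v\ge\psi\ \text{a.e. on }\mathcal M\cap\Omega,\ \ v-\varphi\in H^1_0(\Omega)\},\qquad J(v)=\tfrac12\int_\Omega|\nabla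 v|^2\,dx,$$ and let $u\in\mathbb K$ be a minimizer of $J$ over $\mathbb K$. Let $$\Lambda=\{\lambda\in L^2(\mathcal M):\ \lambda\ge 0\ \text{a.e. on }\mathcal M\},$$ and let $H(\Omega_\pm,\mathrm{div})$ be the set of $q^*\in L^2(\Omega,\mathbb{R}^n)$ whose restrictions to $\Omega_+$ and $\Omega_-$ have weak divergences $\mathrm{div}\,q^*\in L^2(\Omega_\pm)$ and whose jump of normal traces $[q^*\cdot\mathbf n]=q^*\cdot\mathbf n_++q^*\cdot\mathbf n_-$ ($\mathbf n_\pm$ being the outer unit normals to $\Omega_\pm$) belongs to $L^2(\mathcal M)$, that is, there is a function $[q^*\cdot\mathbf n]\in L^2(\mathcal M)$ with $$\int_{\Omega_+}(q^*\cdot\nabla\eta+\eta\,\mathrm{div}\,q^*)\,dx+\int_{\Omega_-}(q^*\cdot\nabla\eta+\eta\,\mathrm{div}\,q^*)\,dx=\int_{\mathcal M}[q^*\cdot\mathbf n]\,\eta\,d\mu\qquad\forall\,\eta\in C_c^\infty(\Omega).$$ Let $C_{F_{\Omega_+}},C_{F_{\Omega_-}},C_{Tr_{\mathcal M}}(\Omega_+),C_{Tr_{\mathcal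 M}}(\Omega_-)\ge0$ be constants in the Friedrichs and trace inequalities $$\|w\|_{\Omega_\pm}\le C_{F_{\Omega_\pm}}\|\nabla w\|_{\Omega_\pm},\qquad \|w\|_{\mathcal M}\le C_{Tr_{\mathcal M}}(\Omega_\pm)\|\nabla w\|_{\Omega_\pm}\qquad\forall\,w\in H^1_0(\Omega),$$ and put $C_{Tr_{\mathcal M}}=\min\{C_{Tr_{\mathcal M}}(\Omega_+),C_{Tr_{\mathcal M}}(\Omega_-)\}$. Then for every $v\in\mathbb K$, every $\lambda\in\Lambda$ and every $q^*\in H(\Omega_\pm,\mathrm{div})$, $$\|\nabla(v-u)\|_\Omega\le\mathfrak M(v,q^*,\lambda,\psi),$$ where $$\mathfrak M(v,q^*,\lambda,\psi)=\|\nabla v-q^*\|_\Omega+\sqrt2\Big(\int_{\mathcal M}\lambda(v-\psi)\,d\mu\Big)^{1/2}+C_{F_{\Omega_+}}\|\mathrm{div}\,q^*\|_{\Omega_+}+C_{F_{\Omega_-}}\|\mathrm{div}\,q^*\|_{\Omega_-}+C_{Tr_{\mathcal M}}\|\lambda-[q^*\cdot\mathbf n]\|_{\mathcal M}.$$ (The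 integrand $\lambda(v-\psi)$ is nonnegative a.e.; if its integral is $+\infty$, the right-hand side is $+\infty$.) -/

import Mathlib

open MeasureTheory Filter Topology
open scoped ENNReal NNReal ContDiff Gradient RealInnerProductSpace

namespace ThinObstacle

/-- Euclidean space of dimension `n`. -/
abbrev E (n : ℕ) := EuclideanSpace ℝ (Fin n)

variable {n : ℕ}

/-! ### Geometry -/

/-- A bounded Lipschitz domain: nonempty, open, connected, bounded, and near each boundary point
it is the strict epigraph of a Lipschitz function over a hyperplane. Here `e` is the unit "vertical"
direction, `⟪e, y⟫` the vertical coordinate of `y`, and `y - ⟪e, y⟫ • e` its projection to the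
hyperplane orthogonal to `e`. -/
structure IsLipschitzDomain (D : Set (E n)) : Prop where
  isOpen : IsOpen D
  isConnected : IsConnected D
  isBounded : Bornology.IsBounded D
  exists_graph : ∀ x ∈ frontier D, ∃ (e : E n) (h : E n → ℝ) (L : ℝ≥0) (r : ℝ),
    ‖e‖ = 1 ∧ LipschitzWith L h ∧ 0 < r ∧
      ∀ y ∈ Metric.ball x r, y ∈ D ↔ h (y - ⟪e, y⟫ • e) < ⟪e, y⟫

/-- A smooth embedded hypersurface (without boundary): locally a regular level set of a smooth
function. -/
def IsSmoothHypersurface (S : Set (E n)) : Prop :=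
  ∀ x ∈ S, ∃ (U : Set (E n)) (F : E n → ℝ), IsOpen U ∧ x ∈ U ∧ ContDiffOn ℝ ∞ F U ∧
    (∀ y ∈ U, fderiv ℝ F y ≠ 0) ∧ ∀ y ∈ U, y ∈ S ↔ F y = 0

/-- `Ω` is a bounded Lipschitz domain that the smooth hypersurface `M` divides into the two
Lipschitz subdomains `Ωp` and `Ωm`. Only the part of `M` inside `Ω` matters; `M` may end on the
boundary of `Ω` or continue outside. -/
structure Divides (M Ω Ωp Ωm : Set (E n)) : Prop where
  domain : IsLipschitzDomain Ω
  domain_p : IsLipschitzDomain Ωp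
  domain_m : IsLipschitzDomain Ωm
  hypersurface : IsSmoothHypersurface (M ∩ Ω)
  disjoint : Disjoint Ωp Ωm
  diff_eq : Ω \ M = Ωp ∪ Ωm

/-- The surface measure on `M ∩ Ω`, i.e. the `(n-1)`-dimensional Hausdorff measure, normalized so
that it is Lebesgue measure on hyperplanes. -/
noncomputable def surf (M Ω : Set (E n)) : Measure (E n) :=
  (Measure.euclideanHausdorffMeasure (n - 1) : Measure (E n)).restrict (M ∩ Ω)

/-! ### Sobolev spaces -/

/-- `η ∈ C_c^∞(D)`. -/
structure IsTestFunction (D : Set (E n)) (η : E n → ℝ) : Prop where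
  contDiff : ContDiff ℝ ∞ η
  hasCompactSupport : HasCompactSupport η
  tsupport_subset : tsupport η ⊆ D

/-- An element of `H¹(Ω)`: a representative of a square integrable function together with a
representative of its square integrable weak gradient. Values outside `Ω` are irrelevant. -/
structure H1 (Ω : Set (E n)) where
  val : E n → ℝ
  grad : E n → E n
  memLp_val : MemLp val 2 (volume.restrict Ω)
  memLp_grad : MemLp grad 2 (volume.restrict Ω)
  weak_grad : ∀ η, IsTestFunction Ω η →
    ∫ x in Ω, val x • ∇ η x = - ∫ x in Ω, η x • grad x

lemma IsTestFunction.memLp {D : Set (E n)} {η : E n → ℝ} (h : IsTestFunction D η)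
    (S : Set (E n)) : MemLp η 2 (volume.restrict S) :=
  (h.contDiff.continuous.memLp_of_hasCompactSupport h.hasCompactSupport).restrict S

lemma IsTestFunction.memLp_gradient {D : Set (E n)} {η : E n → ℝ} (h : IsTestFunction D η)
    (S : Set (E n)) : MemLp (∇ η) 2 (volume.restrict S) := by
  have hc : Continuous (∇ η) :=
    (InnerProductSpace.toDual ℝ (E n)).symm.continuous.comp
      (h.contDiff.continuous_fderiv (by simp))
  have hs : HasCompactSupport (∇ η) :=
    (h.hasCompactSupport.fderiv (𝕜 := ℝ)).comp_left
      (g := (InnerProductSpace.toDual ℝ (E n)).symm) (map_zero _)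
  exact (hc.memLp_of_hasCompactSupport hs).restrict S

/-- Difference in `H¹(Ω)`, formed pointwise. -/
instance (Ω : Set (E n)) : Sub (H1 Ω) where
  sub v w :=
    { val := fun x => v.val x - w.val x
      grad := fun x => v.grad x - w.grad x
      memLp_val := v.memLp_val.sub w.memLp_val
      memLp_grad := v.memLp_grad.sub w.memLp_grad
      weak_grad := by
        intro η hη
        have h1 : ∀ a : H1 Ω, Integrable (fun x => a.val x • ∇ η x) (volume.restrict Ω) :=
          fun a => memLp_one_iff_integrable.1 ((hη.memLp_gradient Ω).smul a.memLp_val)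
        have h2 : ∀ a : H1 Ω, Integrable (fun x => η x • a.grad x) (volume.restrict Ω) :=
          fun a => memLp_one_iff_integrable.1 (a.memLp_grad.smul (hη.memLp Ω))
        simp only [sub_smul, smul_sub]
        rw [integral_sub (h1 v) (h1 w), integral_sub (h2 v) (h2 w), v.weak_grad η hη,
          w.weak_grad η hη]
        abel }

/-- `w ∈ H¹₀(Ω)`, the closure of `C_c^∞(Ω)` in `H¹(Ω)`. -/
def InH10 {Ω : Set (E n)} (w : H1 Ω) : Prop :=
  ∃ η : ℕ → E n → ℝ, (∀ k, IsTestFunction Ω (η k)) ∧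
    Tendsto (fun k => eLpNorm (fun x => η k x - w.val x) 2 (volume.restrict Ω)) atTop (𝓝 0) ∧
    Tendsto (fun k => eLpNorm (fun x => ∇ (η k) x - w.grad x) 2 (volume.restrict Ω)) atTop (𝓝 0)

/-- `g ∈ L²(M ∩ Ω)` is the trace of `w ∈ H¹(Ω)` on `M ∩ Ω`: the value at `w` of the continuous
extension of the restriction map, i.e. `g` is the `L²(M ∩ Ω)`-limit of the restrictions of smooth
functions on the whole space that converge to `w` in `H¹(Ω)`. -/
def IsTrace {Ω : Set (E n)} (M : Set (E n)) (w : H1 Ω) (g : E n → ℝ) : Prop :=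
  MemLp g 2 (surf M Ω) ∧ ∃ f : ℕ → E n → ℝ, (∀ k, ContDiff ℝ ∞ (f k)) ∧
    Tendsto (fun k => eLpNorm (fun x => f k x - w.val x) 2 (volume.restrict Ω)) atTop (𝓝 0) ∧
    Tendsto (fun k => eLpNorm (fun x => ∇ (f k) x - w.grad x) 2 (volume.restrict Ω)) atTop (𝓝 0) ∧
    Tendsto (fun k => eLpNorm (fun x => f k x - g x) 2 (surf M Ω)) atTop (𝓝 0)

/-! ### The thin obstacle problem -/

/-- The convex set `K` of all `v ∈ H¹(Ω)` with `v ≥ ψ` on `M ∩ Ω` (for the trace) and `v = φ` on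
the boundary of `Ω`. The boundary datum, a trace of an `H¹(Ω)` function, is given by such a
function `φ`, so the boundary condition reads `v - φ ∈ H¹₀(Ω)`. -/
def K {Ω : Set (E n)} (M : Set (E n)) (φ : H1 Ω) (ψ : E n → ℝ) : Set (H1 Ω) :=
  {v | InH10 (v - φ) ∧ ∃ g, IsTrace M v g ∧ ∀ᵐ x ∂(surf M Ω), ψ x ≤ g x}

/-- The Dirichlet energy `J`. -/
noncomputable def J {Ω : Set (E n)} (v : H1 Ω) : ℝ := (1 / 2) * ∫ x in Ω, ‖v.grad x‖ ^ 2

/-- The cone `Λ` of nonnegative functions in `L²(M ∩ Ω)`. -/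
def Lam (M Ω : Set (E n)) : Set (E n → ℝ) :=
  {l | MemLp l 2 (surf M Ω) ∧ ∀ᵐ x ∂(surf M Ω), 0 ≤ l x}

/-! ### Vector fields with piecewise divergence -/

/-- `d ∈ L²(D)` is the weak divergence of `q` in the open set `D`. -/
def IsWeakDiv (D : Set (E n)) (q : E n → E n) (d : E n → ℝ) : Prop :=
  MemLp d 2 (volume.restrict D) ∧
    ∀ η, IsTestFunction D η → ∫ x in D, ⟪q x, ∇ η x⟫ = - ∫ x in D, d x * η x

/-- The normal trace `η ↦ ∫_{∂D} (q · n) η` of a field `q` on the boundary of `D`, `n` being the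
outer normal and `d` the divergence of `q` in `D`, defined through Green's formula. -/
noncomputable def normalTrace (D : Set (E n)) (q : E n → E n) (d : E n → ℝ) (η : E n → ℝ) : ℝ :=
  (∫ x in D, ⟪q x, ∇ η x⟫) + ∫ x in D, d x * η x

/-- An element of `H(Ω_±, div)`: a field `q ∈ L²(Ω, ℝⁿ)` whose restrictions to `Ωp` and `Ωm` have
square integrable divergences `divp`, `divm`, and whose jump of normal traces
`[q · n] = q · n₊ + q · n₋` across `M ∩ Ω` is a function `jump ∈ L²(M ∩ Ω)`. -/
structure HDiv (M Ω Ωp Ωm : Set (E n)) where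
  q : E n → E n
  divp : E n → ℝ
  divm : E n → ℝ
  jump : E n → ℝ
  memLp_q : MemLp q 2 (volume.restrict Ω)
  isWeakDiv_p : IsWeakDiv Ωp q divp
  isWeakDiv_m : IsWeakDiv Ωm q divm
  memLp_jump : MemLp jump 2 (surf M Ω)
  jump_eq : ∀ η, IsTestFunction Ω η →
    normalTrace Ωp q divp η + normalTrace Ωm q divm η = ∫ x, jump x * η x ∂(surf M Ω)

/-! ### Constants -/

/-- `C` is a constant in the Friedrichs inequality `‖w‖_D ≤ C ‖∇w‖_D` on the subdomain `D` of `Ω`,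
for functions `w` vanishing on the boundary of `Ω`. -/
def IsFriedrichsConst (Ω D : Set (E n)) (C : ℝ≥0) : Prop :=
  ∀ w : H1 Ω, InH10 w →
    eLpNorm w.val 2 (volume.restrict D) ≤ C * eLpNorm w.grad 2 (volume.restrict D)

/-- `C` is a constant in the trace inequality `‖w‖_M ≤ C ‖∇w‖_D` on the subdomain `D` of `Ω`,
for functions `w` vanishing on the boundary of `Ω`. -/
def IsTraceConst (M Ω D : Set (E n)) (C : ℝ≥0) : Prop :=
  ∀ (w : H1 Ω) (g : E n → ℝ), InH10 w → IsTrace M w g →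
    eLpNorm g 2 (surf M Ω) ≤ C * eLpNorm w.grad 2 (volume.restrict D)

/-! ### The majorant -/

/-- The majorant `𝔐(v, q*, λ, ψ)`, with `vM` the trace of `v`. It is `[0, ∞]`-valued, since the
integral of the (almost everywhere) nonnegative function `λ (v - ψ)` may be infinite. -/
noncomputable def majorant {M Ω Ωp Ωm : Set (E n)} (CFp CFm CTr : ℝ≥0) (v : H1 Ω) (vM : E n → ℝ)
    (q : HDiv M Ω Ωp Ωm) (l ψ : E n → ℝ) : ℝ≥0∞ :=
  eLpNorm (fun x => v.grad x - q.q x) 2 (volume.restrict Ω)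
    + ENNReal.ofReal (√2) * (∫⁻ x, ENNReal.ofReal (l x * (vM x - ψ x)) ∂(surf M Ω)) ^ (1 / 2 : ℝ)
    + CFp * eLpNorm q.divp 2 (volume.restrict Ωp)
    + CFm * eLpNorm q.divm 2 (volume.restrict Ωm)
    + CTr * eLpNorm (fun x => l x - q.jump x) 2 (surf M Ω)

end ThinObstacle

open ThinObstacle

/-! Put w = v - u, which lies in H¹₀(Ω), and e = ‖∇w‖_Ω. Minimality of u on the convex set K gives ∫
∇u·∇w ≥ 0 (`variational_inequality`), so e² ≤ ∫ (∇v - q)·∇w + ∫ q·∇w. Green's formula across M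
(`HDiv.green`) turns the last integral into -∫ div q · w over the two subdomains plus ∫_M [q·n] w.
Write [q·n] = λ - (λ - [q·n]). Since λ ≥ 0 and u ≥ ψ on M, ∫_M λ w ≤ S := ∫_M λ(v - ψ).
Cauchy–Schwarz with the Friedrichs and trace inequalities bounds the remaining terms by A e, where A
is the majorant without its S term. Thus e² ≤ A e + S, and `le_add_sqrt_two_mul_sqrt` concludes.

Green's formula is given only for test functions; it passes to H¹₀ by density. This needs test
functions to be square integrable on M, i.e. surface measure finite on compact subsets of Ω, and
splitting ∫_Ω needs M ∩ Ω to be Lebesgue null. Both follow from the local finiteness of the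
Hausdorff measure of a regular level set. -/

namespace ThinObstacle

/-! ### Surface measure of the hypersurface. -/

variable {n : ℕ}

/-- Near a regular point, a level set of a strictly differentiable function has finite
`(n-1)`-dimensional Hausdorff measure. -/
lemma exists_nhds_hausdorff_levelSet_lt_top {F : E n → ℝ} {x : E n} {F' : E n →L[ℝ] ℝ}
    (hF : HasStrictFDerivAt F F' x) (hF' : F' ≠ 0) {S : Set (E n)}
    (hS : ∀ᶠ y in 𝓝 x, y ∈ S → F y = 0) :
    ∃ V ∈ 𝓝 x, (Measure.euclideanHausdorffMeasure (n - 1) : Measure (E n)) (S ∩ V) < ⊤ := by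
  obtain ⟨e, he⟩ : ∃ e, F' e = 1 := by
    obtain ⟨z, hz⟩ : ∃ z, F' z ≠ 0 := by
      by_contra! h
      exact hF' (ContinuousLinearMap.ext h)
    exact ⟨(F' z)⁻¹ • z, by simp [hz]⟩
  -- Projection along `e` onto the (n-1)-dimensional kernel. Its restriction to the level set will
  -- have a Lipschitz inverse.
  let P : E n →L[ℝ] F'.ker :=
    (ContinuousLinearMap.id ℝ (E n) - F'.smulRight e).codRestrict F'.ker
      (fun z => by simp [he])
  have hP : ∀ z, (P z : E n) = z - F' z • e := fun z => by simp [P]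
  -- Chosen so that c‖e‖ ≤ 1/2: for w a difference of two points of the level set, ‖F' w‖ ≤ c‖w‖, so
  -- the part of w lost by `P` is at most ‖w‖/2. Hence the antilipschitz constant 2.
  let c : ℝ≥0 := ⟨1 / (2 * (‖e‖ + 1)), by positivity⟩
  have hc : (0 : ℝ≥0) < c := by
    rw [← NNReal.coe_pos]
    change (0 : ℝ) < 1 / (2 * (‖e‖ + 1))
    positivity
  obtain ⟨V₁, hV₁, hV₁'⟩ := hF.approximates_deriv_on_nhds (Or.inr hc)
  -- The ball serves only to make `P '' V` bounded, hence of finite measure in the kernel.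
  let V := (V₁ ∩ {y | y ∈ S → F y = 0}) ∩ Metric.ball x 1
  have hVx : V ∈ 𝓝 x := inter_mem (inter_mem hV₁ hS) (Metric.ball_mem_nhds x one_pos)
  refine ⟨V, hVx, ?_⟩
  let T : Set (E n) := S ∩ V
  have hanti : AntilipschitzWith 2 (fun y : T => P y) := by
    refine AntilipschitzWith.of_le_mul_dist fun y z => ?_
    have hy : F y = 0 := y.2.2.1.2 y.2.1
    have hz : F z = 0 := z.2.2.1.2 z.2.1
    have h1 := hV₁' y y.2.2.1.1 z z.2.2.1.1
    simp only [hy, hz, sub_self, zero_sub, norm_neg] at h1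
    rw [Subtype.dist_eq, dist_eq_norm, dist_eq_norm, ← map_sub]
    change _ ≤ _ * ‖(P ((y : E n) - z) : E n)‖
    rw [hP]
    set w : E n := (y : E n) - z
    have h2 : ‖w‖ ≤ ‖w - F' w • e‖ + ‖F' w‖ * ‖e‖ := by
      rw [← norm_smul]
      simpa using norm_add_le (w - F' w • e) (F' w • e)
    have h3 : ‖F' w‖ * ‖e‖ ≤ 1 / 2 * ‖w‖ := by
      calc ‖F' w‖ * ‖e‖ ≤ (1 / (2 * (‖e‖ + 1)) * ‖w‖) * ‖e‖ := by gcongr; exact h1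
        _ = 1 / 2 * ‖w‖ * (‖e‖ / (‖e‖ + 1)) := by field_simp
        _ ≤ 1 / 2 * ‖w‖ * 1 := by
          gcongr
          rw [div_le_one (by positivity)]
          linarith
        _ = _ := by ring
    push_cast
    linarith
  have hrank : Module.finrank ℝ F'.ker = n - 1 := by
    have h1 := LinearMap.finrank_range_add_finrank_ker (F' : E n →ₗ[ℝ] ℝ)
    have h2 : LinearMap.range (F' : E n →ₗ[ℝ] ℝ) = ⊤ := by
      rw [LinearMap.range_eq_top]
      exact fun r => ⟨r • e, by simp [he]⟩
    rw [h2, finrank_top, Module.finrank_self, finrank_euclideanSpace_fin] at h1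
    change Module.finrank ℝ (LinearMap.ker (F' : E n →ₗ[ℝ] ℝ)) = n - 1
    omega
  have hbdd : Bornology.IsBounded (P '' V) :=
    (P.lipschitz.isBounded_image (Metric.isBounded_ball.subset Set.inter_subset_right))
  have hfin : (Measure.euclideanHausdorffMeasure (n - 1) : Measure F'.ker) (P '' V) < ⊤ := by
    rw [← hrank]
    exact hbdd.measure_lt_top
  -- The antilipschitz map lives on the subtype `T`, so the measure of `T` is computed intrinsically
  -- there.
  have himg : (Measure.euclideanHausdorffMeasure (n - 1) : Measure (E n)) T =
      (Measure.euclideanHausdorffMeasure (n - 1) : Measure T) Set.univ := by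
    rw [← (isometry_subtype_coe (s := T)).euclideanHausdorffMeasure_image, Set.image_univ,
      Subtype.range_coe]
  change (Measure.euclideanHausdorffMeasure (n - 1) : Measure (E n)) T < ⊤
  rw [himg]
  rw [Measure.euclideanHausdorffMeasure_def, Measure.smul_apply, ENNReal.smul_def, smul_eq_mul] at hfin ⊢
  have hle := hanti.le_hausdorffMeasure_image (d := ((n - 1 : ℕ) : ℝ)) (by positivity) Set.univ
  have hsub : (fun y : T => P y) '' Set.univ ⊆ P '' V := by
    rintro _ ⟨y, -, rfl⟩
    exact ⟨y, y.2.2, rfl⟩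
  refine lt_of_le_of_lt (mul_le_mul_right (hle.trans (mul_le_mul_right (measure_mono hsub) _)) _) ?_
  rw [mul_left_comm]
  exact ENNReal.mul_lt_top (by simp) hfin

lemma IsSmoothHypersurface.exists_nhds_lt_top {S : Set (E n)} (hS : IsSmoothHypersurface S)
    {x : E n} (hx : x ∈ S) :
    ∃ V ∈ 𝓝 x, (Measure.euclideanHausdorffMeasure (n - 1) : Measure (E n)) (S ∩ V) < ⊤ := by
  obtain ⟨U, F, hU, hxU, hF, hF', hUS⟩ := hS x hx
  refine exists_nhds_hausdorff_levelSet_lt_top (F := F)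
    ((hF.contDiffAt (hU.mem_nhds hxU)).hasStrictFDerivAt (by simp)) (hF' x hxU) ?_
  filter_upwards [hU.mem_nhds hxU] with y hy using (hUS y hy).1

/-- Locally finite Hausdorff measure in dimension n-1 forces measure zero in dimension n. For n = 0
the truncated n-1 would not be smaller than n. -/
lemma IsSmoothHypersurface.volume_eq_zero {S : Set (E n)} (hn : 1 ≤ n)
    (hS : IsSmoothHypersurface S) : volume S = 0 := by
  refine measure_null_of_locally_null S fun x hx => ?_
  obtain ⟨V, hV, hlt⟩ := hS.exists_nhds_lt_top hx
  refine ⟨S ∩ V, inter_mem_nhdsWithin S hV, ?_⟩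
  rw [← EuclideanSpace.euclideanHausdorffMeasure_eq_volume]
  exact (Measure.euclideanHausdorffMeasure_zero_or_top
    (show n - 1 < n by omega) _).resolve_right hlt.ne

variable {M Ω Ωp Ωm : Set (E n)}

lemma Divides.measurableSet_inter (h : Divides M Ω Ωp Ωm) : MeasurableSet (M ∩ Ω) := by
  have : M ∩ Ω = Ω \ (Ωp ∪ Ωm) := by
    rw [← h.diff_eq, Set.sdiff_sdiff_right_self, Set.inter_comm]
  rw [this]
  exact h.domain.isOpen.measurableSet.diff
    (h.domain_p.isOpen.union h.domain_m.isOpen).measurableSet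

/-- Local finiteness plus compactness: near points of M the level-set bound applies, and points off
M lie in the open set Ωp ∪ Ωm, which carries no surface measure. -/
lemma Divides.surf_lt_top (h : Divides M Ω Ωp Ωm) {k : Set (E n)} (hk : IsCompact k)
    (hkΩ : k ⊆ Ω) : surf M Ω k < ⊤ := by
  refine hk.measure_lt_top_of_nhdsWithin fun x hx => ?_
  by_cases hxM : x ∈ M
  · obtain ⟨V, hV, hlt⟩ := h.hypersurface.exists_nhds_lt_top ⟨hxM, hkΩ hx⟩
    refine ⟨V, mem_nhdsWithin_of_mem_nhds hV, ?_⟩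
    rwa [surf, Measure.restrict_apply' h.measurableSet_inter, Set.inter_comm]
  · have hx' : x ∈ Ωp ∪ Ωm := h.diff_eq ▸ ⟨hkΩ hx, hxM⟩
    refine ⟨Ωp ∪ Ωm, mem_nhdsWithin_of_mem_nhds
      ((h.domain_p.isOpen.union h.domain_m.isOpen).mem_nhds hx'), ?_⟩
    rw [surf, Measure.restrict_apply' h.measurableSet_inter, ← h.diff_eq]
    have : Ω \ M ∩ (M ∩ Ω) = ∅ := by ext; simp; tauto
    simp [this]

/-- Finiteness of the surface measure is available only on compact subsets of Ω, so the measure is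
first restricted to the support of η. -/
lemma Divides.memLp_surf (h : Divides M Ω Ωp Ωm) {η : E n → ℝ} (hη : IsTestFunction Ω η) :
    MemLp η 2 (surf M Ω) := by
  have hfin : IsFiniteMeasure ((surf M Ω).restrict (tsupport η)) :=
    isFiniteMeasure_restrict.2 (h.surf_lt_top hη.hasCompactSupport hη.tsupport_subset).ne
  have := hη.contDiff.continuous.memLp_of_hasCompactSupport (p := 2)
    (μ := (surf M Ω).restrict (tsupport η)) hη.hasCompactSupport
  rw [← memLp_indicator_iff_restrict (isClosed_tsupport η).measurableSet] at this
  convert this using 1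
  symm
  rw [Set.indicator_eq_self]
  exact subset_tsupport η

lemma Divides.restrict_eq (hn : 1 ≤ n) (h : Divides M Ω Ωp Ωm) :
    (volume.restrict Ω : Measure (E n)) = volume.restrict Ωp + volume.restrict Ωm := by
  rw [← Measure.restrict_union h.disjoint h.domain_m.isOpen.measurableSet, ← h.diff_eq]
  refine Measure.restrict_congr_set (ae_eq_set.2 ⟨?_, by simp⟩)
  rw [Set.sdiff_sdiff_right_self, Set.inter_comm]
  exact h.hypersurface.volume_eq_zero hn

lemma Divides.subset_p (h : Divides M Ω Ωp Ωm) : Ωp ⊆ Ω :=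
  fun _ hx => ((h.diff_eq ▸ Or.inl hx : _ ∈ Ω \ M)).1

lemma Divides.subset_m (h : Divides M Ω Ωp Ωm) : Ωm ⊆ Ω :=
  fun _ hx => ((h.diff_eq ▸ Or.inr hx : _ ∈ Ω \ M)).1

end ThinObstacle

/-! ### Pairings and limits in L²; linear structure of H¹, H¹₀ and traces. -/

namespace ThinObstacle

variable {n : ℕ}

section L2

variable {α F : Type*} [MeasurableSpace α] {μ : Measure α} [NormedAddCommGroup F]
  [InnerProductSpace ℝ F]

lemma integral_inner_eq_inner_toLp {f g : α → F} (hf : MemLp f 2 μ) (hg : MemLp g 2 μ) :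
    ∫ x, ⟪f x, g x⟫ ∂μ = ⟪hf.toLp f, hg.toLp g⟫ := by
  rw [L2.inner_def]
  refine integral_congr_ae ?_
  filter_upwards [hf.coeFn_toLp, hg.coeFn_toLp] with x h1 h2
  rw [h1, h2]

lemma integrable_inner_of_memLp {f g : α → F} (hf : MemLp f 2 μ) (hg : MemLp g 2 μ) :
    Integrable (fun x => ⟪f x, g x⟫) μ := by
  refine (L2.integrable_inner (𝕜 := ℝ) (hf.toLp f) (hg.toLp g)).congr ?_
  filter_upwards [hf.coeFn_toLp, hg.coeFn_toLp] with x h1 h2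
  rw [h1, h2]

lemma abs_integral_inner_le {f g : α → F} (hf : MemLp f 2 μ) (hg : MemLp g 2 μ) :
    |∫ x, ⟪f x, g x⟫ ∂μ| ≤ (eLpNorm f 2 μ).toReal * (eLpNorm g 2 μ).toReal := by
  rw [integral_inner_eq_inner_toLp hf hg, ← Lp.norm_toLp f hf, ← Lp.norm_toLp g hg]
  exact abs_real_inner_le_norm _ _

lemma integral_inner_self {f : α → F} (hf : MemLp f 2 μ) :
    ∫ x, ⟪f x, f x⟫ ∂μ = (eLpNorm f 2 μ).toReal ^ 2 := by
  rw [integral_inner_eq_inner_toLp hf hf, ← Lp.norm_toLp f hf, real_inner_self_eq_norm_sq]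

lemma tendsto_integral_inner {f g : α → F} {h : ℕ → α → F} (hf : MemLp f 2 μ)
    (hg : MemLp g 2 μ) (hh : ∀ k, MemLp (h k) 2 μ)
    (ht : Tendsto (fun k => eLpNorm (fun x => h k x - g x) 2 μ) atTop (𝓝 0)) :
    Tendsto (fun k => ∫ x, ⟪f x, h k x⟫ ∂μ) atTop (𝓝 (∫ x, ⟪f x, g x⟫ ∂μ)) := by
  rw [tendsto_iff_norm_sub_tendsto_zero]
  have h0 : Tendsto (fun k => (eLpNorm f 2 μ).toReal *
      (eLpNorm (fun x => h k x - g x) 2 μ).toReal) atTop (𝓝 0) := by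
    simpa using ((ENNReal.tendsto_toReal ENNReal.zero_ne_top).comp ht).const_mul
      (eLpNorm f 2 μ).toReal
  refine squeeze_zero (fun _ => norm_nonneg _) (fun k => ?_) h0
  rw [← integral_sub (integrable_inner_of_memLp hf (hh k)) (integrable_inner_of_memLp hf hg)]
  simp only [← inner_sub_right]
  exact abs_integral_inner_le hf ((hh k).sub hg)

lemma tendsto_integral_mul {f g : α → ℝ} {h : ℕ → α → ℝ} (hf : MemLp f 2 μ)
    (hg : MemLp g 2 μ) (hh : ∀ k, MemLp (h k) 2 μ)
    (ht : Tendsto (fun k => eLpNorm (fun x => h k x - g x) 2 μ) atTop (𝓝 0)) :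
    Tendsto (fun k => ∫ x, f x * h k x ∂μ) atTop (𝓝 (∫ x, f x * g x ∂μ)) := by
  simpa [mul_comm] using tendsto_integral_inner hf hg hh ht

lemma integrable_mul_of_memLp {f g : α → ℝ} (hf : MemLp f 2 μ) (hg : MemLp g 2 μ) :
    Integrable (fun x => f x * g x) μ := by
  simpa [mul_comm] using integrable_inner_of_memLp hf hg

lemma abs_integral_mul_le {f g : α → ℝ} (hf : MemLp f 2 μ) (hg : MemLp g 2 μ) :
    |∫ x, f x * g x ∂μ| ≤ (eLpNorm f 2 μ).toReal * (eLpNorm g 2 μ).toReal := by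
  simpa [mul_comm] using abs_integral_inner_le hf hg

lemma tendsto_eLpNorm_lincomb {f g : ℕ → α → F} {f₀ g₀ : α → F}
    (hf : ∀ k, AEStronglyMeasurable (f k) μ) (hf₀ : AEStronglyMeasurable f₀ μ)
    (hg : ∀ k, AEStronglyMeasurable (g k) μ) (hg₀ : AEStronglyMeasurable g₀ μ) (a b : ℝ)
    (h1 : Tendsto (fun k => eLpNorm (fun x => f k x - f₀ x) 2 μ) atTop (𝓝 0))
    (h2 : Tendsto (fun k => eLpNorm (fun x => g k x - g₀ x) 2 μ) atTop (𝓝 0)) :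
    Tendsto (fun k => eLpNorm (fun x => (a • f k x + b • g k x) - (a • f₀ x + b • g₀ x)) 2 μ)
      atTop (𝓝 0) := by
  have h0 : Tendsto (fun k => ‖a‖ₑ * eLpNorm (fun x => f k x - f₀ x) 2 μ +
      ‖b‖ₑ * eLpNorm (fun x => g k x - g₀ x) 2 μ) atTop (𝓝 0) := by
    simpa using (ENNReal.Tendsto.const_mul h1 (Or.inr enorm_ne_top)).add
      (ENNReal.Tendsto.const_mul h2 (Or.inr enorm_ne_top))
  refine tendsto_of_tendsto_of_tendsto_of_le_of_le tendsto_const_nhds h0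
    (fun _ => zero_le) fun k => ?_
  rw [← eLpNorm_const_smul, ← eLpNorm_const_smul]
  refine le_trans (le_of_eq ?_) (eLpNorm_add_le (((hf k).sub hf₀).const_smul a)
    (((hg k).sub hg₀).const_smul b) (by norm_num))
  congr 1
  ext x
  simp only [Pi.add_apply, Pi.smul_apply, smul_sub]
  abel

end L2

lemma continuous_gradient {f : E n → ℝ} (hf : ContDiff ℝ ∞ f) : Continuous (∇ f) :=
  (InnerProductSpace.toDual ℝ (E n)).symm.continuous.comp (hf.continuous_fderiv (by simp))

lemma gradient_lincomb {f g : E n → ℝ} (hf : ContDiff ℝ ∞ f) (hg : ContDiff ℝ ∞ g) (a b : ℝ)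
    (x : E n) : ∇ (fun y => a • f y + b • g y) x = a • ∇ f x + b • ∇ g x := by
  have h1 : DifferentiableAt ℝ f x := hf.differentiable (by simp) x
  have h2 : DifferentiableAt ℝ g x := hg.differentiable (by simp) x
  have := ((h1.hasFDerivAt.const_smul a).add (h2.hasFDerivAt.const_smul b)).fderiv
  simp only [gradient]
  change (InnerProductSpace.toDual ℝ (E n)).symm
    (fderiv ℝ (a • f + b • g) x) = _
  rw [this]
  simp

lemma IsTestFunction.lincomb {D : Set (E n)} {f g : E n → ℝ} (hf : IsTestFunction D f)
    (hg : IsTestFunction D g) (a b : ℝ) : IsTestFunction D (fun x => a • f x + b • g x) where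
  contDiff := (hf.contDiff.const_smul a).add (hg.contDiff.const_smul b)
  hasCompactSupport := (hf.hasCompactSupport.smul_left (f := fun _ => a)).add
    (hg.hasCompactSupport.smul_left (f := fun _ => b))
  tsupport_subset := by
    refine (tsupport_add _ _).trans (Set.union_subset ?_ ?_)
    · exact (tsupport_smul_subset_right (fun _ => a) f).trans hf.tsupport_subset
    · exact (tsupport_smul_subset_right (fun _ => b) g).trans hg.tsupport_subset

variable {Ω : Set (E n)}

namespace H1

lemma integrable_val_smul_gradient (v : H1 Ω) {η : E n → ℝ} (hη : IsTestFunction Ω η) :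
    Integrable (fun x => v.val x • ∇ η x) (volume.restrict Ω) :=
  memLp_one_iff_integrable.1 ((hη.memLp_gradient Ω).smul v.memLp_val)

lemma integrable_smul_grad (v : H1 Ω) {η : E n → ℝ} (hη : IsTestFunction Ω η) :
    Integrable (fun x => η x • v.grad x) (volume.restrict Ω) :=
  memLp_one_iff_integrable.1 (v.memLp_grad.smul (hη.memLp Ω))

/-- The linear combination `a v + b w` in `H¹(Ω)`, formed pointwise. -/
def lincomb (a b : ℝ) (v w : H1 Ω) : H1 Ω where
  val x := a • v.val x + b • w.val x
  grad x := a • v.grad x + b • w.grad x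
  memLp_val := (v.memLp_val.const_smul a).add (w.memLp_val.const_smul b)
  memLp_grad := (v.memLp_grad.const_smul a).add (w.memLp_grad.const_smul b)
  weak_grad η hη := by
    simp only [add_smul, smul_add, smul_assoc, smul_comm (η _)]
    have h1 := integral_add ((v.integrable_val_smul_gradient hη).smul a)
      ((w.integrable_val_smul_gradient hη).smul b)
    have h2 := integral_add ((v.integrable_smul_grad hη).smul a)
      ((w.integrable_smul_grad hη).smul b)
    simp only [Pi.smul_apply, integral_smul] at h1 h2
    rw [h1, h2, v.weak_grad η hη, w.weak_grad η hη]
    module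

lemma eq_of_val_grad {v w : H1 Ω} (h1 : v.val = w.val) (h2 : v.grad = w.grad) : v = w := by
  cases v; cases w; simp_all

lemma sub_eq_lincomb (v w : H1 Ω) : v - w = lincomb 1 (-1) v w :=
  eq_of_val_grad (funext fun x => show v.val x - w.val x = (1 : ℝ) • v.val x + (-1 : ℝ) • w.val x by
      module)
    (funext fun x => show v.grad x - w.grad x = (1 : ℝ) • v.grad x + (-1 : ℝ) • w.grad x by module)

lemma lincomb_sub (t : ℝ) (v w z : H1 Ω) :
    lincomb (1 - t) t v w - z = lincomb (1 - t) t (v - z) (w - z) :=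
  eq_of_val_grad
    (funext fun x => show (1 - t) • v.val x + t • w.val x - z.val x =
      (1 - t) • (v.val x - z.val x) + t • (w.val x - z.val x) by module)
    (funext fun x => show (1 - t) • v.grad x + t • w.grad x - z.grad x =
      (1 - t) • (v.grad x - z.grad x) + t • (w.grad x - z.grad x) by module)

lemma sub_sub_sub (v w z : H1 Ω) : (v - z) - (w - z) = v - w :=
  eq_of_val_grad
    (funext fun x => show (v.val x - z.val x) - (w.val x - z.val x) = v.val x - w.val x by abel)
    (funext fun x => show (v.grad x - z.grad x) - (w.grad x - z.grad x) = v.grad x - w.grad x by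
      abel)

end H1

/-- A test function as an element of `H¹(Ω)`. -/
noncomputable def IsTestFunction.toH1 {η : E n → ℝ} (hη : IsTestFunction Ω η) : H1 Ω where
  val := η
  grad := ∇ η
  memLp_val := hη.memLp Ω
  memLp_grad := hη.memLp_gradient Ω
  weak_grad ζ hζ := by
    have hI : ∀ {f g : E n → ℝ}, IsTestFunction Ω f → IsTestFunction Ω g →
        Integrable (fun x => f x • ∇ g x) := fun {f g} hf hg => by
      have h1 := hf.memLp Set.univ
      have h2 := hg.memLp_gradient Set.univ
      rw [Measure.restrict_univ] at h1 h2
      exact memLp_one_iff_integrable.1 (h2.smul h1)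
    have hz : ∀ {f : E n → ℝ}, IsTestFunction Ω f → ∀ x, x ∉ Ω → f x = 0 := fun hf x hx =>
      image_eq_zero_of_notMem_tsupport fun h => hx (hf.tsupport_subset h)
    -- Both integrands vanish off Ω, so one may integrate by parts on the whole space, where no
    -- boundary term appears.
    rw [setIntegral_eq_integral_of_forall_compl_eq_zero (fun x hx => by rw [hz hη x hx, zero_smul]),
      setIntegral_eq_integral_of_forall_compl_eq_zero (fun x hx => by rw [hz hζ x hx, zero_smul])]
    -- Pairing with a fixed vector reduces the vector identity to directional derivatives.
    refine ext_inner_left ℝ fun a => ?_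
    have hd : ∀ {f : E n → ℝ}, ∀ x, ⟪a, ∇ f x⟫ = fderiv ℝ f x a := fun {f} x => by
      rw [inner_gradient_right]; simp
    have h1 := (hI hη hζ).const_inner (𝕜 := ℝ) a
    have h2 := (hI hζ hη).const_inner (𝕜 := ℝ) a
    rw [inner_neg_right, ← integral_inner (hI hη hζ), ← integral_inner (hI hζ hη)]
    simp only [inner_smul_right, hd] at h1 h2 ⊢
    rw [integral_mul_fderiv_eq_neg_fderiv_mul_of_integrable]
    · simp only [mul_comm]
    · simpa only [mul_comm] using h2
    · exact h1
    · exact (hη.contDiff.continuous.mul hζ.contDiff.continuous).integrable_of_hasCompactSupport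
        hη.hasCompactSupport.mul_right
    · exact fun x _ => hη.contDiff.differentiable (by simp) x
    · exact fun x _ => hζ.contDiff.differentiable (by simp) x

lemma IsTestFunction.inH10_toH1 {η : E n → ℝ} (hη : IsTestFunction Ω η) : InH10 hη.toH1 :=
  ⟨fun _ => η, fun _ => hη, by simp [toH1], by simp [toH1]⟩

lemma IsTestFunction.isTrace_toH1 {M : Set (E n)} {η : E n → ℝ} (hη : IsTestFunction Ω η)
    (h : MemLp η 2 (surf M Ω)) : IsTrace M hη.toH1 η :=
  ⟨h, fun _ => η, fun _ => hη.contDiff, by simp [toH1], by simp [toH1], by simp⟩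

lemma InH10.lincomb {v w : H1 Ω} (hv : InH10 v) (hw : InH10 w) (a b : ℝ) :
    InH10 (H1.lincomb a b v w) := by
  obtain ⟨f, hf, hf1, hf2⟩ := hv
  obtain ⟨g, hg, hg1, hg2⟩ := hw
  refine ⟨fun k x => a • f k x + b • g k x, fun k => (hf k).lincomb (hg k) a b, ?_, ?_⟩
  · exact tendsto_eLpNorm_lincomb (fun k => (hf k).contDiff.continuous.aestronglyMeasurable)
      v.memLp_val.1 (fun k => (hg k).contDiff.continuous.aestronglyMeasurable) w.memLp_val.1
      a b hf1 hg1
  · simp only [gradient_lincomb (hf _).contDiff (hg _).contDiff]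
    exact tendsto_eLpNorm_lincomb
      (fun k => (continuous_gradient (hf k).contDiff).aestronglyMeasurable)
      v.memLp_grad.1 (fun k => (continuous_gradient (hg k).contDiff).aestronglyMeasurable)
      w.memLp_grad.1 a b hf2 hg2

lemma IsTrace.lincomb {M : Set (E n)} {v w : H1 Ω} {s t : E n → ℝ} (hv : IsTrace M v s)
    (hw : IsTrace M w t) (a b : ℝ) :
    IsTrace M (H1.lincomb a b v w) (fun x => a • s x + b • t x) := by
  obtain ⟨hs, f, hf, hf1, hf2, hf3⟩ := hv
  obtain ⟨ht, g, hg, hg1, hg2, hg3⟩ := hw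
  refine ⟨(hs.const_smul a).add (ht.const_smul b), fun k x => a • f k x + b • g k x,
    fun k => ((hf k).const_smul a).add ((hg k).const_smul b), ?_, ?_, ?_⟩
  · exact tendsto_eLpNorm_lincomb (fun k => (hf k).continuous.aestronglyMeasurable)
      v.memLp_val.1 (fun k => (hg k).continuous.aestronglyMeasurable) w.memLp_val.1
      a b hf1 hg1
  · simp only [gradient_lincomb (hf _) (hg _)]
    exact tendsto_eLpNorm_lincomb
      (fun k => (continuous_gradient (hf k)).aestronglyMeasurable)
      v.memLp_grad.1 (fun k => (continuous_gradient (hg k)).aestronglyMeasurable)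
      w.memLp_grad.1 a b hf2 hg2
  · exact tendsto_eLpNorm_lincomb (fun k => (hf k).continuous.aestronglyMeasurable)
      hs.1 (fun k => (hg k).continuous.aestronglyMeasurable) ht.1 a b hf3 hg3

end ThinObstacle

/-! ### Variational inequality, Green's formula and the final estimate. -/

namespace ThinObstacle

variable {n : ℕ} {M Ω Ωp Ωm : Set (E n)}

/-- Convexity of K: the segment from u to v consists of competitors for u. -/
lemma K.lincomb_mem {φ : H1 Ω} {ψ : E n → ℝ} {u v : H1 Ω} (hu : u ∈ K M φ ψ) (hv : v ∈ K M φ ψ)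
    {t : ℝ} (ht0 : 0 ≤ t) (ht1 : t ≤ 1) : H1.lincomb (1 - t) t u v ∈ K M φ ψ := by
  obtain ⟨hu0, g, hg, hψg⟩ := hu
  obtain ⟨hv0, h, hh, hψh⟩ := hv
  refine ⟨?_, _, hg.lincomb hh (1 - t) t, ?_⟩
  · rw [H1.lincomb_sub]
    exact hu0.lincomb hv0 _ _
  · filter_upwards [hψg, hψh] with x h1 h2
    simp only [smul_eq_mul]
    nlinarith [mul_le_mul_of_nonneg_left h1 (sub_nonneg.2 ht1), mul_le_mul_of_nonneg_left h2 ht0]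

lemma InH10.sub {φ v u : H1 Ω} (hv : InH10 (v - φ)) (hu : InH10 (u - φ)) : InH10 (v - u) := by
  rw [← H1.sub_sub_sub v u φ, H1.sub_eq_lincomb]
  exact hv.lincomb hu _ _

lemma IsTrace.sub {v u : H1 Ω} {s t : E n → ℝ} (hv : IsTrace M v s) (hu : IsTrace M u t) :
    IsTrace M (v - u) (fun x => s x - t x) := by
  rw [H1.sub_eq_lincomb]
  simpa [sub_eq_add_neg] using hv.lincomb hu 1 (-1)

/-- If `0 ≤ t a + t² b` for all small `t > 0`, then `0 ≤ a`. -/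
lemma nonneg_of_forall_mul_add_sq {a b : ℝ} (h : ∀ t : ℝ, 0 < t → t ≤ 1 → 0 ≤ t * a + t ^ 2 * b) :
    0 ≤ a := by
  have h1 : ∀ t ∈ Set.Ioc (0 : ℝ) 1, 0 ≤ a + t * b := fun t ht => by
    have := h t ht.1 ht.2
    exact nonneg_of_mul_nonneg_right (show 0 ≤ t * (a + t * b) by linarith) ht.1
  have h2 : Tendsto (fun t : ℝ => a + t * b) (𝓝[>] 0) (𝓝 (a + 0 * b)) :=
    ((continuous_const.add (continuous_id.mul continuous_const)).tendsto 0).mono_left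
      nhdsWithin_le_nhds
  have h3 := ge_of_tendsto h2 (Filter.mem_of_superset (Ioc_mem_nhdsGT one_pos) h1)
  simpa using h3

/-- The variational inequality for a minimizer of the Dirichlet energy. -/
lemma variational_inequality {φ : H1 Ω} {ψ : E n → ℝ} {u v : H1 Ω} (hu : u ∈ K M φ ψ)
    (hmin : ∀ v ∈ K M φ ψ, J u ≤ J v) (hv : v ∈ K M φ ψ) :
    0 ≤ ∫ x in Ω, ⟪u.grad x, (v - u).grad x⟫ := by
  -- With w = v - u, J(u + t w) - J(u) = t ∫ ∇u·∇w + t² · ½∫ |∇w|²; `b` is the second coefficient.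
  refine nonneg_of_forall_mul_add_sq (b := 1 / 2 * ∫ x in Ω, ⟪(v - u).grad x, (v - u).grad x⟫)
    fun t ht0 ht1 => ?_
  have h := hmin _ (K.lincomb_mem hu hv ht0.le ht1)
  have hw := (v - u).memLp_grad
  have i1 := integrable_inner_of_memLp u.memLp_grad u.memLp_grad
  have i2 := integrable_inner_of_memLp u.memLp_grad hw
  have i3 := integrable_inner_of_memLp hw hw
  have hexp : ∀ x, ‖(H1.lincomb (1 - t) t u v).grad x‖ ^ 2 = ⟪u.grad x, u.grad x⟫ +
      2 * t * ⟪u.grad x, (v - u).grad x⟫ + t ^ 2 * ⟪(v - u).grad x, (v - u).grad x⟫ := fun x => by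
    have : (H1.lincomb (1 - t) t u v).grad x = u.grad x + t • (v - u).grad x := by
      change (1 - t) • u.grad x + t • v.grad x = u.grad x + t • (v.grad x - u.grad x)
      module
    rw [this, ← real_inner_self_eq_norm_sq]
    simp only [inner_add_left, inner_add_right, real_inner_smul_left, real_inner_smul_right,
      real_inner_comm (u.grad x)]
    ring
  simp only [J, hexp, ← real_inner_self_eq_norm_sq] at h
  have i12 : Integrable (fun x => ⟪u.grad x, u.grad x⟫ + 2 * t * ⟪u.grad x, (v - u).grad x⟫)
    (volume.restrict Ω) := i1.add (i2.const_mul _)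
  rw [integral_add i12 (i3.const_mul _), integral_add i1 (i2.const_mul _), integral_const_mul,
    integral_const_mul] at h
  linarith

/-- Green's formula across `M` for functions in `H¹₀(Ω)`. -/
lemma HDiv.green (hM : Divides M Ω Ωp Ωm) (q : HDiv M Ω Ωp Ωm) {D : Set (E n)} (hD : D ⊆ Ω)
    {C : ℝ≥0} (hC : IsTraceConst M Ω D C) {w : H1 Ω} (hw : InH10 w) {g : E n → ℝ}
    (hg : IsTrace M w g) :
    ((∫ x in Ωp, ⟪q.q x, w.grad x⟫) + ∫ x in Ωp, q.divp x * w.val x) +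
      ((∫ x in Ωm, ⟪q.q x, w.grad x⟫) + ∫ x in Ωm, q.divm x * w.val x) =
    ∫ x, q.jump x * g x ∂(surf M Ω) := by
  obtain ⟨η, hη, h1, h2⟩ := id hw
  have hmono : ∀ {A : Set (E n)}, A ⊆ Ω → volume.restrict A ≤ volume.restrict Ω :=
    fun h => Measure.restrict_mono h le_rfl
  have hη₂ := fun k => hM.memLp_surf (hη k)
  have hsq : ∀ {A : Set (E n)} {F : Type} [NormedAddCommGroup F] (f : ℕ → E n → F), A ⊆ Ω →
      Tendsto (fun k => eLpNorm (f k) 2 (volume.restrict Ω)) atTop (𝓝 0) →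
      Tendsto (fun k => eLpNorm (f k) 2 (volume.restrict A)) atTop (𝓝 0) := fun f hA h =>
    tendsto_of_tendsto_of_tendsto_of_le_of_le tendsto_const_nhds h (fun _ => zero_le)
      fun k => eLpNorm_mono_measure _ (hmono hA)
  -- Membership in H¹₀ says nothing about convergence on M. The trace inequality applied to η k - w,
  -- whose trace is η k - g, supplies it.
  have h3 : Tendsto (fun k => eLpNorm (fun x => η k x - g x) 2 (surf M Ω)) atTop (𝓝 0) := by
    have h0 : Tendsto (fun k => (C : ℝ≥0∞) *
        eLpNorm (fun x => ∇ (η k) x - w.grad x) 2 (volume.restrict D)) atTop (𝓝 0) := by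
      simpa using ENNReal.Tendsto.const_mul (hsq _ hD h2) (Or.inr ENNReal.coe_ne_top)
    refine tendsto_of_tendsto_of_tendsto_of_le_of_le tendsto_const_nhds h0 (fun _ => zero_le)
      fun k => hC ((hη k).toH1 - w) _ ?_ (((hη k).isTrace_toH1 (hη₂ k)).sub hg)
    rw [H1.sub_eq_lincomb]
    exact (hη k).inH10_toH1.lincomb hw _ _
  have hp := hM.subset_p
  have hm := hM.subset_m
  -- The formula holds for every η k; both of its sides converge, each pairing being continuous in
  -- L².
  refine tendsto_nhds_unique ?_ (tendsto_integral_mul q.memLp_jump hg.1 hη₂ h3)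
  simp only [← q.jump_eq _ (hη _), normalTrace]
  refine ((tendsto_integral_inner ?_ ?_ ?_ ?_).add (tendsto_integral_mul ?_ ?_ ?_ ?_)).add
    ((tendsto_integral_inner ?_ ?_ ?_ ?_).add (tendsto_integral_mul ?_ ?_ ?_ ?_))
  · exact q.memLp_q.mono_measure (hmono hp)
  · exact w.memLp_grad.mono_measure (hmono hp)
  · exact fun k => (hη k).memLp_gradient _
  · exact hsq _ hp h2
  · exact q.isWeakDiv_p.1
  · exact w.memLp_val.mono_measure (hmono hp)
  · exact fun k => (hη k).memLp _
  · exact hsq _ hp h1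
  · exact q.memLp_q.mono_measure (hmono hm)
  · exact w.memLp_grad.mono_measure (hmono hm)
  · exact fun k => (hη k).memLp_gradient _
  · exact hsq _ hm h2
  · exact q.isWeakDiv_m.1
  · exact w.memLp_val.mono_measure (hmono hm)
  · exact fun k => (hη k).memLp _
  · exact hsq _ hm h1

lemma toReal_eLpNorm_le_mul {α F G : Type*} [MeasurableSpace α] [NormedAddCommGroup F]
    [NormedAddCommGroup G] {μ ν : Measure α} {f : α → F} {g : α → G} {C : ℝ≥0}
    (hg : MemLp g 2 ν) (h : eLpNorm f 2 μ ≤ C * eLpNorm g 2 ν) :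
    (eLpNorm f 2 μ).toReal ≤ C * (eLpNorm g 2 ν).toReal := by
  have := ENNReal.toReal_mono (ENNReal.mul_ne_top ENNReal.coe_ne_top hg.2.ne) h
  rwa [ENNReal.toReal_mul] at this

/-- If e > a + √s, then e and e - a both exceed √s, so e(e - a) > s. This gives the constant 1 in
front of √s; the factor √2 only weakens it. -/
lemma le_add_sqrt_two_mul_sqrt {e a s : ℝ} (ha : 0 ≤ a) (hs : 0 ≤ s)
    (h : e ^ 2 ≤ a * e + s) : e ≤ a + √2 * √s := by
  have h1 : (1 : ℝ) ≤ √2 := by rw [Real.one_le_sqrt]; norm_num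
  have h2 := Real.sq_sqrt hs
  have h3 := Real.sqrt_nonneg s
  have h4 : e ≤ a + √s := by
    by_contra! hc
    nlinarith
  nlinarith

/-- Dropping the negative part of f leaves a comparison of lower integrals, so g, in the application
λ(v - ψ), need be neither measurable nor integrable. -/
lemma integral_le_toReal_lintegral {α : Type*} [MeasurableSpace α] {μ : Measure α} {f g : α → ℝ}
    (hf : Integrable f μ) (hfg : f ≤ᵐ[μ] g) (hg : ∫⁻ x, ENNReal.ofReal (g x) ∂μ ≠ ⊤) :
    ∫ x, f x ∂μ ≤ (∫⁻ x, ENNReal.ofReal (g x) ∂μ).toReal := by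
  rw [integral_eq_lintegral_pos_part_sub_lintegral_neg_part hf]
  refine (sub_le_self _ ENNReal.toReal_nonneg).trans (ENNReal.toReal_mono hg ?_)
  exact lintegral_mono_ae (hfg.mono fun x hx => ENNReal.ofReal_le_ofReal hx)

/-- Carries the real-valued estimate back to the [0, ∞]-valued form of the majorant once all terms
are finite. -/
lemma le_of_toReal_le {e a p m j S : ℝ≥0∞} {Cp Cm Cj : ℝ≥0} (he : e ≠ ⊤) (ha : a ≠ ⊤)
    (hp : p ≠ ⊤) (hm : m ≠ ⊤) (hj : j ≠ ⊤) (hS : S ≠ ⊤)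
    (h : e.toReal ≤ (a.toReal + Cp * p.toReal + Cm * m.toReal + Cj * j.toReal) +
      √2 * √S.toReal) :
    e ≤ a + ENNReal.ofReal √2 * S ^ (1 / 2 : ℝ) + Cp * p + Cm * m + Cj * j := by
  rw [← ENNReal.ofReal_toReal he]
  refine (ENNReal.ofReal_le_ofReal h).trans (le_of_eq ?_)
  have hsqrt : ENNReal.ofReal √S.toReal = S ^ (1 / 2 : ℝ) := by
    rw [Real.sqrt_eq_rpow, ENNReal.toReal_rpow,
      ENNReal.ofReal_toReal (ENNReal.rpow_ne_top_of_nonneg (by norm_num) hS)]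
  rw [ENNReal.ofReal_add (by positivity) (by positivity),
    ENNReal.ofReal_add (by positivity) (by positivity),
    ENNReal.ofReal_add (by positivity) (by positivity),
    ENNReal.ofReal_add (by positivity) (by positivity),
    ENNReal.ofReal_mul (by positivity), ENNReal.ofReal_mul (by positivity),
    ENNReal.ofReal_mul (by positivity), ENNReal.ofReal_mul (by positivity), hsqrt,
    ENNReal.ofReal_toReal ha, ENNReal.ofReal_toReal hp, ENNReal.ofReal_toReal hm,
    ENNReal.ofReal_toReal hj]
  simp only [ENNReal.ofReal_coe_nnreal]
  ring

end ThinObstacle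

open ThinObstacle
theorem theorem2p4 {n : ℕ} (hn : 1 ≤ n) (M Ω Ωp Ωm : Set (E n)) (hM : Divides M Ω Ωp Ωm)
    (CFp CFm CTrp CTrm : ℝ≥0)
    (hFp : IsFriedrichsConst Ω Ωp CFp) (hFm : IsFriedrichsConst Ω Ωm CFm)
    (hTp : IsTraceConst M Ω Ωp CTrp) (hTm : IsTraceConst M Ω Ωm CTrm)
    (φ : H1 Ω) (ψ : E n → ℝ) (hψ : ContDiffOn ℝ ∞ ψ (M ∩ Ω))
    (u : H1 Ω) (hu : u ∈ K M φ ψ) (hmin : ∀ v ∈ K M φ ψ, J u ≤ J v)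
    (v : H1 Ω) (hv : v ∈ K M φ ψ) (vM : E n → ℝ) (hvM : IsTrace M v vM)
    (l : E n → ℝ) (hl : l ∈ Lam M Ω) (q : HDiv M Ω Ωp Ωm) :
    eLpNorm (v - u).grad 2 (volume.restrict Ω)
      ≤ majorant CFp CFm (min CTrp CTrm) v vM q l ψ := by
  have hvi := variational_inequality hu hmin hv
  obtain ⟨hu0, uM, huM, hψu⟩ := hu
  have hw0 : InH10 (v - u) := hv.1.sub hu0
  have hwM := hvM.sub huM
  have hgreen := q.green hM hM.subset_p hTp hw0 hwM
  obtain ⟨hlL, hl0⟩ := hl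
  set S : ℝ≥0∞ := ∫⁻ x, ENNReal.ofReal (l x * (vM x - ψ x)) ∂(surf M Ω) with hS
  unfold majorant
  rw [← hS]
  -- If S is infinite so is the majorant, its coefficient √2 being nonzero.
  rcases eq_or_ne S ⊤ with hStop | hStop
  · rw [hStop, ENNReal.top_rpow_of_pos (by norm_num), ENNReal.mul_top (by simp)]
    simp
  -- Here the obstacle enters: u ≥ ψ and λ ≥ 0 give λ(v - u) ≤ λ(v - ψ).
  have hS' : ∫ x, l x * (vM x - uM x) ∂(surf M Ω) ≤ S.toReal := by
    refine integral_le_toReal_lintegral (integrable_mul_of_memLp hlL hwM.1) ?_ hStop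
    filter_upwards [hψu, hl0] with x h1 h2
    gcongr
  set w := v - u with hw
  have hmono : ∀ {A : Set (E n)}, A ⊆ Ω → volume.restrict A ≤ volume.restrict Ω :=
    fun h => Measure.restrict_mono h le_rfl
  have hqw := integrable_inner_of_memLp q.memLp_q w.memLp_grad
  have hvq : MemLp (fun x => v.grad x - q.q x) 2 (volume.restrict Ω) := v.memLp_grad.sub q.memLp_q
  have hlj : MemLp (fun x => l x - q.jump x) 2 (surf M Ω) := hlL.sub q.memLp_jump
  have hgp := w.memLp_grad.mono_measure (hmono hM.subset_p)
  have hgm := w.memLp_grad.mono_measure (hmono hM.subset_m)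
  have hsplit : ∫ x in Ω, ⟪q.q x, w.grad x⟫ =
      (∫ x in Ωp, ⟪q.q x, w.grad x⟫) + ∫ x in Ωm, ⟪q.q x, w.grad x⟫ := by
    rw [hM.restrict_eq hn] at hqw ⊢
    exact integral_add_measure hqw.left_of_add_measure hqw.right_of_add_measure
  have hpe : (eLpNorm w.grad 2 (volume.restrict Ωp)).toReal ≤
      (eLpNorm w.grad 2 (volume.restrict Ω)).toReal :=
    ENNReal.toReal_mono w.memLp_grad.2.ne (eLpNorm_mono_measure _ (hmono hM.subset_p))
  have hme : (eLpNorm w.grad 2 (volume.restrict Ωm)).toReal ≤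
      (eLpNorm w.grad 2 (volume.restrict Ω)).toReal :=
    ENNReal.toReal_mono w.memLp_grad.2.ne (eLpNorm_mono_measure _ (hmono hM.subset_m))
  set e := (eLpNorm w.grad 2 (volume.restrict Ω)).toReal with he
  have hFp' := (toReal_eLpNorm_le_mul hgp (hFp w hw0)).trans
    (mul_le_mul_of_nonneg_left hpe CFp.coe_nonneg)
  have hFm' := (toReal_eLpNorm_le_mul hgm (hFm w hw0)).trans
    (mul_le_mul_of_nonneg_left hme CFm.coe_nonneg)
  have hTp' := (toReal_eLpNorm_le_mul hgp (hTp w _ hw0 hwM)).trans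
    (mul_le_mul_of_nonneg_left hpe CTrp.coe_nonneg)
  have hTm' := (toReal_eLpNorm_le_mul hgm (hTm w _ hw0 hwM)).trans
    (mul_le_mul_of_nonneg_left hme CTrm.coe_nonneg)
  -- Either one-sided trace inequality bounds the same trace on M once its gradient norm is enlarged
  -- to Ω, so the smaller constant is allowed.
  have hT : (eLpNorm (fun x => vM x - uM x) 2 (surf M Ω)).toReal ≤ (min CTrp CTrm : ℝ≥0) * e := by
    rcases min_choice CTrp CTrm with h | h <;> rw [h] <;> assumption
  have b1 := abs_le.1 (abs_integral_inner_le hvq w.memLp_grad)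
  have b2 := abs_le.1 ((abs_integral_mul_le q.isWeakDiv_p.1
    (w.memLp_val.mono_measure (hmono hM.subset_p))).trans
      (mul_le_mul_of_nonneg_left hFp' ENNReal.toReal_nonneg))
  have b3 := abs_le.1 ((abs_integral_mul_le q.isWeakDiv_m.1
    (w.memLp_val.mono_measure (hmono hM.subset_m))).trans
      (mul_le_mul_of_nonneg_left hFm' ENNReal.toReal_nonneg))
  have b4 := abs_le.1 ((abs_integral_mul_le hlj hwM.1).trans
      (mul_le_mul_of_nonneg_left hT ENNReal.toReal_nonneg))
  have hself := integral_inner_self w.memLp_grad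
  -- Splits ∇w = (∇v - q) + q - ∇u; the last term contributes with a favourable sign by `hvi`.
  have c1 : ∫ x in Ω, ⟪w.grad x, w.grad x⟫ = (∫ x in Ω, ⟪v.grad x - q.q x, w.grad x⟫) +
      (∫ x in Ω, ⟪q.q x, w.grad x⟫) - ∫ x in Ω, ⟪u.grad x, w.grad x⟫ := by
    have i1 := integrable_inner_of_memLp hvq w.memLp_grad
    have i2 : Integrable (fun x => ⟪v.grad x - q.q x, w.grad x⟫ + ⟪q.q x, w.grad x⟫)
      (volume.restrict Ω) := i1.add hqw
    rw [← integral_add i1 hqw, ← integral_sub i2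
      (integrable_inner_of_memLp u.memLp_grad w.memLp_grad)]
    refine integral_congr_ae (ae_of_all _ fun x => ?_)
    simp only [← inner_add_left, ← inner_sub_left, sub_add_cancel]
    rfl
  have c2 : ∫ x, (l x - q.jump x) * (vM x - uM x) ∂(surf M Ω) =
      (∫ x, l x * (vM x - uM x) ∂(surf M Ω)) - ∫ x, q.jump x * (vM x - uM x) ∂(surf M Ω) := by
    rw [← integral_sub (integrable_mul_of_memLp hlL hwM.1)
      (integrable_mul_of_memLp q.memLp_jump hwM.1)]
    simp only [sub_mul]
  set A := (eLpNorm (fun x => v.grad x - q.q x) 2 (volume.restrict Ω)).toReal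
    + CFp * (eLpNorm q.divp 2 (volume.restrict Ωp)).toReal
    + CFm * (eLpNorm q.divm 2 (volume.restrict Ωm)).toReal
    + (min CTrp CTrm : ℝ≥0) * (eLpNorm (fun x => l x - q.jump x) 2 (surf M Ω)).toReal with hA
  have hA0 : 0 ≤ A := by positivity
  have key : e ≤ A + √2 * √S.toReal := by
    refine le_add_sqrt_two_mul_sqrt hA0 ENNReal.toReal_nonneg ?_
    have h0 : e ^ 2 = ∫ x in Ω, ⟪w.grad x, w.grad x⟫ := hself.symm
    rw [h0, c1, hsplit, hA]
    -- Green's formula `hgreen` replaces ∫ q·∇w, `c2` introduces λ, and `hS'` bounds the λ term. The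
    -- divergence terms and the term in λ - [q·n] enter with a minus sign, hence their lower bounds.
    linarith [b1.2, b2.1, b3.1, b4.1]
  exact le_of_toReal_le w.memLp_grad.2.ne hvq.2.ne q.isWeakDiv_p.1.2.ne q.isWeakDiv_m.1.2.ne
    hlj.2.ne hStop key
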